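/- Consider a unit-demand matching market with a finite set $\mathcal{B}$ of buyers, a finite set $\mathcal{M}$ of goods, $|\mathcal{B}|=|\mathcal{M}|$, and valuations $v_{ij}\ge 0$ ($i\in\mathcal{B}$, $j\in\mathcal{M}$). For a price vector $P\in\mathbb{R}^{\mathcal{M}}$, the preference graph joins buyer $i$ and good $j$ if $v_{ij}-P_j\ge 0$ and $v_{ij}-P_j=\max_{k}(v_{ik}-P_k)$. The vector $P$ is market clearing if its preference graph has a perfect matching. Let $N(\cdot)$ denote neighbourhoods in the preference graph. A set $S\subseteq\mathcal{M}$ is a constricted good set if $|S|>|N(S)|$; the skewness of a non-empty $S\subseteq\mathcal{M}$ is $|S|-|N(S)|+\frac{1}{|S|}$, and $S$ is maximally skewed if it maximizes the skewness over all non-empty sets of goods. The skew-aided descending price algorithm starts at $P_j=\max_i v_{ij}$. As long as a constricted good set exists, it takes the maximally skewed set $S$ and lowers the price of every good in $S$ by $$c=\min_{i\in\mathcal{B}\setminus N(S),\ l\in S}\Big\{\max\Big(0,\max_{k\in\mathcal{M}\setminus S}(v_{ik}-P_k)\Big)-(v_{il}-P_l)\Big\};$$ it stops when there is no constricted good set.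 Then the algorithm stops after finitely many rounds. In every round before it stops, the maximally skewed set is unique and is a constricted good set, and $c>0$. The final price vector is non-negative and market clearing, and it is the maximum market-clearing price vector: it is coordinatewise at least as large as every market-clearing price vector. Moreover, at the final prices every non-empty set $A$ of buyers satisfies $|A|<|N^D(A)|$, where $N^D$ is the neighbourhood in the preference graph of the market with one additional dummy good $D$ of price $0$ and of value $0$ to every buyer. -/

import Mathlib

namespace MatchingMarket

noncomputable section

open scoped Classical

/-- The edges of the preference graph. At prices `P`, buyer `b` with valuations `v b` prefers
good `j` if `j` maximizes the surplus `v b j - P j` over all goods and this surplus is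
non-negative. -/
def Prefers {B G : Type*} (v : B → G → ℝ) (P : G → ℝ) (b : B) (j : G) : Prop :=
  0 ≤ v b j - P j ∧ ∀ k, v b k - P k ≤ v b j - P j

/-- `N(S)`: the buyers adjacent to some good of `S` in the preference graph. -/
def buyersOf {B G : Type*} [Fintype B] (v : B → G → ℝ) (P : G → ℝ) (S : Finset G) : Finset B :=
  Finset.univ.filter fun b => ∃ j ∈ S, Prefers v P b j

/-- `N(A)`: the goods adjacent to some buyer of `A` in the preference graph. -/
def goodsOf {B G : Type*} [Fintype G] (v : B → G → ℝ) (P : G → ℝ) (A : Finset B) : Finset G :=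
  Finset.univ.filter fun j => ∃ b ∈ A, Prefers v P b j

/-- `N^D(A)`: the neighbourhood of `A` after adding one dummy good (`none`), which has price
zero and is worth zero to every buyer. -/
def goodsOfWithDummy {B M : Type*} [Fintype M] (v : B → M → ℝ) (P : M → ℝ) (A : Finset B) :
    Finset (Option M) :=
  goodsOf (fun b (j : Option M) => j.elim 0 (v b)) (fun j : Option M => j.elim 0 P) A

/-- A price vector is market clearing if its preference graph has a perfect matching. -/
def IsMarketClearing {B M : Type*} (v : B → M → ℝ) (P : M → ℝ) : Prop :=
  ∃ σ : B ≃ M, ∀ b, Prefers v P b (σ b)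

variable {B M : Type*} [Fintype B] [Fintype M]

/-- A constricted good set: it has strictly more goods than neighbours. -/
def IsConstricted (v : B → M → ℝ) (P : M → ℝ) (S : Finset M) : Prop :=
  (buyersOf v P S).card < S.card

/-- The skewness `|S| - |N(S)| + 1 / |S|` of a non-empty set of goods. -/
def skewness (v : B → M → ℝ) (P : M → ℝ) (S : Finset M) : ℝ :=
  (S.card : ℝ) - ((buyersOf v P S).card : ℝ) + 1 / (S.card : ℝ)

/-- `S` maximizes the skewness among all non-empty sets of goods. -/
def IsMaximallySkewed (v : B → M → ℝ) (P : M → ℝ) (S : Finset M) : Prop :=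
  S.Nonempty ∧ ∀ S' : Finset M, S'.Nonempty → skewness v P S' ≤ skewness v P S

/-- A maximally skewed set (one exists as soon as there is a good). -/
def maximallySkewedSet (v : B → M → ℝ) (P : M → ℝ) : Finset M :=
  if h : ∃ S, IsMaximallySkewed v P S then h.choose else ∅

/-- The best surplus that buyer `b` can get without buying a good of `S`: the maximum of `0`
(not buying) and of the surpluses `v b k - P k` for `k ∉ S`. -/
def outsideSurplus (v : B → M → ℝ) (P : M → ℝ) (S : Finset M) (b : B) : ℝ :=
  (insert 0 ((Finset.univ \ S).image fun k => v b k - P k)).max' (Finset.insert_nonempty _ _)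

/-- The price reduction for the set `S`: the minimum, over buyers `b ∉ N(S)` and goods `l ∈ S`,
of the best surplus of `b` outside `S` minus the surplus of `b` at `l`. For a constricted `S` in
a market with as many buyers as goods the minimum is over a non-empty finite set. -/
def priceReduction (v : B → M → ℝ) (P : M → ℝ) (S : Finset M) : ℝ :=
  sInf {c | ∃ b ∉ buyersOf v P S, ∃ l ∈ S, c = outsideSurplus v P S b - (v b l - P l)}

/-- Lower the prices of all goods of `S` by the price reduction for `S`. -/
def lowerPrices (v : B → M → ℝ) (P : M → ℝ) (S : Finset M) : M → ℝ :=
  fun j => if j ∈ S then P j - priceReduction v P S else P j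

/-- The initial price of a good is the highest valuation that a buyer has for it. -/
def initialPrices (v : B → M → ℝ) : M → ℝ := fun j => ⨆ b, v b j

/-- The stopping condition: there is no constricted good set. -/
def Stops (v : B → M → ℝ) (P : M → ℝ) : Prop := ¬ ∃ S, IsConstricted v P S

/-- One round of the algorithm: unless it stops, it lowers the prices on the maximally skewed
set. -/
def round (v : B → M → ℝ) (P : M → ℝ) : M → ℝ :=
  if Stops v P then P else lowerPrices v P (maximallySkewedSet v P)

/-- The price vector after `t` rounds of the skew-aided descending price algorithm. -/
def prices (v : B → M → ℝ) : ℕ → M → ℝ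
  | 0 => initialPrices v
  | t + 1 => round v (prices v t)

end

end MatchingMarket

namespace MatchingMarket

noncomputable section

open scoped Classical

variable {B M : Type*}

/-! The excess `|S| - |N(S)|` is supermodular, so its maximizers are closed under intersection. It
is an integer and `1 / |S|` breaks ties towards small sets, so before stopping the maximally skewed
set is the least maximizer of the excess (`IsMaximallySkewed.isLeastMaxExcess`).

The maximal skewness has finitely many possible values and drops in every round
(`skewness_lowerPrices_lt`), so the algorithm stops; Hall's theorem then gives a perfect matching.
Leastness of `S` keeps prices above every market-clearing vector (`IsMarketClearing.le_lowerPrices`)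
and preserves `StrictHall`, which yields non-negative prices and the dummy-good inequality. -/

theorem mem_buyersOf [Fintype B] {v : B → M → ℝ} {P : M → ℝ} {S : Finset M} {b : B} :
    b ∈ buyersOf v P S ↔ ∃ j ∈ S, Prefers v P b j := by
  simp [buyersOf]

theorem mem_goodsOf [Fintype M] {v : B → M → ℝ} {P : M → ℝ} {A : Finset B} {j : M} :
    j ∈ goodsOf v P A ↔ ∃ b ∈ A, Prefers v P b j := by
  simp [goodsOf]

/-! ### Excess and the maximally skewed set -/

/-- The number of goods of `S` minus the number of their neighbours. -/
def excess [Fintype B] (v : B → M → ℝ) (P : M → ℝ) (S : Finset M) : ℤ :=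
  (S.card : ℤ) - ((buyersOf v P S).card : ℤ)

theorem isConstricted_iff_excess_pos [Fintype B] {v : B → M → ℝ} {P : M → ℝ} {S : Finset M} :
    IsConstricted v P S ↔ 0 < excess v P S := by
  unfold IsConstricted excess
  omega

theorem skewness_eq_excess_add [Fintype B] (v : B → M → ℝ) (P : M → ℝ) (S : Finset M) :
    skewness v P S = (excess v P S : ℝ) + 1 / (S.card : ℝ) := by
  simp [skewness, excess]

theorem excess_empty [Fintype B] (v : B → M → ℝ) (P : M → ℝ) : excess v P ∅ = 0 := by
  simp [excess, buyersOf]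

theorem excess_add_excess_le [Fintype B] (v : B → M → ℝ) (P : M → ℝ) (S T : Finset M) :
    excess v P S + excess v P T ≤ excess v P (S ∩ T) + excess v P (S ∪ T) := by
  have hunion : buyersOf v P (S ∪ T) = buyersOf v P S ∪ buyersOf v P T := by
    ext b
    simp only [mem_buyersOf, Finset.mem_union, or_and_right, exists_or]
  have hinter : buyersOf v P (S ∩ T) ⊆ buyersOf v P S ∩ buyersOf v P T := by
    intro b hb
    obtain ⟨j, hj, h⟩ := mem_buyersOf.1 hb
    rw [Finset.mem_inter] at hj
    exact Finset.mem_inter.2 ⟨mem_buyersOf.2 ⟨j, hj.1, h⟩, mem_buyersOf.2 ⟨j, hj.2, h⟩⟩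
  have h1 := Finset.card_le_card hinter
  have h2 := Finset.card_union_add_card_inter (buyersOf v P S) (buyersOf v P T)
  have h3 := Finset.card_union_add_card_inter S T
  unfold excess
  rw [hunion]
  omega

/-- `S` has positive excess and is the least set of maximal excess. -/
def IsLeastMaxExcess [Fintype B] (v : B → M → ℝ) (P : M → ℝ) (S : Finset M) : Prop :=
  0 < excess v P S ∧ ∀ T, excess v P T ≤ excess v P S ∧ (excess v P T = excess v P S → S ⊆ T)

theorem IsLeastMaxExcess.nonempty [Fintype B] {v : B → M → ℝ} {P : M → ℝ} {S : Finset M}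
    (h : IsLeastMaxExcess v P S) : S.Nonempty := by
  rw [Finset.nonempty_iff_ne_empty]
  rintro rfl
  have := h.1
  rw [excess_empty] at this
  exact lt_irrefl _ this

theorem IsLeastMaxExcess.excess_lt_of_ssubset [Fintype B] {v : B → M → ℝ} {P : M → ℝ}
    {S T : Finset M} (h : IsLeastMaxExcess v P S) (hT : T ⊂ S) :
    excess v P T < excess v P S :=
  lt_of_le_of_ne (h.2 T).1 fun he => hT.2 ((h.2 T).2 he)

/-- As `1 / |S|` lies in `(0, 1]`, skewness compares excess first and then prefers fewer goods. If
`T` ties with `S`, supermodularity makes `S ∩ T` a maximizer too, hence `S ∩ T = S`. -/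
theorem IsMaximallySkewed.isLeastMaxExcess [Fintype B] {v : B → M → ℝ} {P : M → ℝ}
    {S : Finset M} (hS : IsMaximallySkewed v P S) (hP : ¬ Stops v P) :
    IsLeastMaxExcess v P S := by
  have hle : ∀ T : Finset M, T.Nonempty → excess v P T ≤ excess v P S ∧
      (excess v P T = excess v P S → S.card ≤ T.card) := by
    intro T hT
    have h := hS.2 T hT
    rw [skewness_eq_excess_add, skewness_eq_excess_add] at h
    have hT0 : (0 : ℝ) < T.card := by exact_mod_cast hT.card_pos
    have hS0 : (0 : ℝ) < S.card := by exact_mod_cast hS.1.card_pos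
    have hS1 : 1 / (S.card : ℝ) ≤ 1 := by
      rw [div_le_one hS0]
      exact_mod_cast hS.1.card_pos
    have hT1 : 0 < 1 / (T.card : ℝ) := by positivity
    constructor
    · have : (excess v P T : ℝ) < (excess v P S : ℝ) + 1 := by linarith
      have : excess v P T < excess v P S + 1 := by exact_mod_cast this
      omega
    · intro he
      rw [he, add_le_add_iff_left, one_div_le_one_div hT0 hS0] at h
      exact_mod_cast h
  obtain ⟨C, hC⟩ := not_not.1 hP
  have hC0 := isConstricted_iff_excess_pos.1 hC
  have hCne : C.Nonempty := by
    rw [Finset.nonempty_iff_ne_empty]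
    rintro rfl
    rw [excess_empty] at hC0
    exact lt_irrefl _ hC0
  have hpos : 0 < excess v P S := hC0.trans_le (hle C hCne).1
  have hmax : ∀ T, excess v P T ≤ excess v P S := by
    intro T
    rcases T.eq_empty_or_nonempty with rfl | hT
    · rw [excess_empty]
      exact hpos.le
    · exact (hle T hT).1
  refine ⟨hpos, fun T => ⟨hmax T, fun he => ?_⟩⟩
  have hsum := excess_add_excess_le v P S T
  have hun := hmax (S ∪ T)
  have hin := hmax (S ∩ T)
  have heq : excess v P (S ∩ T) = excess v P S := by omega
  have hne : (S ∩ T).Nonempty := by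
    rw [Finset.nonempty_iff_ne_empty]
    intro h
    rw [h, excess_empty] at heq
    omega
  have := Finset.eq_of_subset_of_card_le Finset.inter_subset_left ((hle _ hne).2 heq)
  rw [← this]
  exact Finset.inter_subset_right

theorem exists_isMaximallySkewed [Fintype B] [Fintype M] {v : B → M → ℝ} {P : M → ℝ}
    (hP : ¬ Stops v P) : ∃ S, IsMaximallySkewed v P S := by
  obtain ⟨C, hC⟩ := not_not.1 hP
  have hCne : C.Nonempty := Finset.card_pos.1 (lt_of_le_of_lt (Nat.zero_le _) hC)
  obtain ⟨S, hS, hmax⟩ := Finset.exists_max_image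
    (Finset.univ.filter fun S : Finset M => S.Nonempty) (skewness v P) ⟨C, by simpa using hCne⟩
  exact ⟨S, by simpa using hS, fun T hT => hmax T (by simpa using hT)⟩

theorem isMaximallySkewed_maximallySkewedSet [Fintype B] [Fintype M] {v : B → M → ℝ} {P : M → ℝ}
    (hP : ¬ Stops v P) : IsMaximallySkewed v P (maximallySkewedSet v P) := by
  have h := exists_isMaximallySkewed hP
  rw [maximallySkewedSet, dif_pos h]
  exact h.choose_spec

theorem existsUnique_isMaximallySkewed [Fintype B] [Fintype M] {v : B → M → ℝ} {P : M → ℝ}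
    (hP : ¬ Stops v P) : ∃! S, IsMaximallySkewed v P S := by
  obtain ⟨S, hS⟩ := exists_isMaximallySkewed hP
  refine ⟨S, hS, fun T hT => ?_⟩
  have hS' := hS.isLeastMaxExcess hP
  have hT' := hT.isLeastMaxExcess hP
  have he : excess v P T = excess v P S := le_antisymm (hS'.2 T).1 (hT'.2 S).1
  exact Finset.Subset.antisymm ((hT'.2 S).2 he.symm) ((hS'.2 T).2 he)

theorem IsLeastMaxExcess.isConstricted [Fintype B] {v : B → M → ℝ} {P : M → ℝ} {S : Finset M}
    (hS : IsLeastMaxExcess v P S) : IsConstricted v P S :=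
  isConstricted_iff_excess_pos.2 hS.1

/-! ### Outside options and the price reduction -/

theorem outsideSurplus_le_iff [Fintype M] {v : B → M → ℝ} {P : M → ℝ} {S : Finset M} {b : B} {x : ℝ} :
    outsideSurplus v P S b ≤ x ↔ 0 ≤ x ∧ ∀ k ∉ S, v b k - P k ≤ x := by
  simp [outsideSurplus, Finset.max'_le_iff]

/-- A buyer with a positive outside option has positive surplus. -/
theorem exists_pos_of_outsideSurplus_pos [Fintype M] {v : B → M → ℝ} {P : M → ℝ} {S : Finset M}
    {b : B} (h : 0 < outsideSurplus v P S b) :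
    ∃ k, 0 < v b k - P k := by
  by_contra! hle
  exact absurd (outsideSurplus_le_iff.2 ⟨le_rfl, fun k _ => hle k⟩) (not_le.2 h)

section Round

variable [Fintype B] [Fintype M] {v : B → M → ℝ} {P : M → ℝ} {S : Finset M}

/-- A buyer who prefers no good of `S` strictly prefers the outside option to all of `S`. -/
theorem lt_outsideSurplus {b : B} (hb : b ∉ buyersOf v P S) {l : M} (hl : l ∈ S) :
    v b l - P l < outsideSurplus v P S b := by
  obtain ⟨m, hm, hmax⟩ := S.exists_max_image (fun k => v b k - P k) ⟨l, hl⟩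
  by_contra! h
  obtain ⟨h0, hout⟩ := outsideSurplus_le_iff.1 (h.trans (hmax l hl))
  refine hb (mem_buyersOf.2 ⟨m, hm, h0, fun k => ?_⟩)
  by_cases hk : k ∈ S
  · exact hmax k hk
  · exact hout k hk

theorem finite_setOf_reductions (v : B → M → ℝ) (P : M → ℝ) (S : Finset M) :
    {c | ∃ b ∉ buyersOf v P S, ∃ l ∈ S, c = outsideSurplus v P S b - (v b l - P l)}.Finite := by
  refine (Set.finite_range fun p : B × M =>
    outsideSurplus v P S p.1 - (v p.1 p.2 - P p.2)).subset ?_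
  rintro c ⟨b, -, l, -, rfl⟩
  exact ⟨(b, l), rfl⟩

theorem add_priceReduction_le {b : B} (hb : b ∉ buyersOf v P S) {l : M} (hl : l ∈ S) :
    v b l - P l + priceReduction v P S ≤ outsideSurplus v P S b := by
  have : priceReduction v P S ≤ outsideSurplus v P S b - (v b l - P l) :=
    csInf_le (finite_setOf_reductions v P S).bddBelow ⟨b, hb, l, hl, rfl⟩
  linarith

theorem exists_add_priceReduction_eq (hcard : Fintype.card B = Fintype.card M)
    (hS : IsConstricted v P S) : ∃ b ∉ buyersOf v P S, ∃ l ∈ S,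
      v b l - P l + priceReduction v P S = outsideSurplus v P S b := by
  have hne : S.Nonempty := Finset.card_pos.1 (lt_of_le_of_lt (Nat.zero_le _) hS)
  -- The infimum is over a non-empty set because `|N(S)| < |S| ≤ |M| = |B|`; on an empty set `sInf`
  -- would be the default `0`.
  have hex : ∃ b, b ∉ buyersOf v P S := by
    by_contra! h
    have h1 : (buyersOf v P S).card = Fintype.card B := by
      rw [Finset.eq_univ_iff_forall.2 h, Finset.card_univ]
    have h2 := S.card_le_univ
    unfold IsConstricted at hS
    omega
  obtain ⟨b, hb⟩ := hex
  obtain ⟨l, hl⟩ := hne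
  obtain ⟨b', hb', l', hl', he⟩ := Set.Nonempty.csInf_mem
    (s := {c | ∃ b ∉ buyersOf v P S, ∃ l ∈ S, c = outsideSurplus v P S b - (v b l - P l)})
    ⟨_, b, hb, l, hl, rfl⟩ (finite_setOf_reductions v P S)
  refine ⟨b', hb', l', hl', ?_⟩
  change priceReduction v P S = _ at he
  linarith

theorem priceReduction_pos (hcard : Fintype.card B = Fintype.card M)
    (hS : IsConstricted v P S) : 0 < priceReduction v P S := by
  obtain ⟨b, hb, l, hl, he⟩ := exists_add_priceReduction_eq hcard hS
  linarith [lt_outsideSurplus hb hl]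

/-! ### Effect of one round on the preference graph -/

theorem lowerPrices_of_mem {j : M} (hj : j ∈ S) :
    lowerPrices v P S j = P j - priceReduction v P S := if_pos hj

theorem lowerPrices_of_notMem {j : M} (hj : j ∉ S) : lowerPrices v P S j = P j := if_neg hj

theorem Prefers.lowerPrices_of_mem (hc : 0 ≤ priceReduction v P S) {b : B} {j : M}
    (h : Prefers v P b j) (hj : j ∈ S) : Prefers v (lowerPrices v P S) b j := by
  have h0 := h.1
  refine ⟨by rw [MatchingMarket.lowerPrices_of_mem hj]; linarith, fun k => ?_⟩
  have hk := h.2 k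
  rw [MatchingMarket.lowerPrices_of_mem hj]
  by_cases hkS : k ∈ S
  · rw [MatchingMarket.lowerPrices_of_mem hkS]
    linarith
  · rw [lowerPrices_of_notMem hkS]
    linarith

/-- The reduction is small enough that no good of `S` overtakes the outside option of a buyer
outside `N(S)`. -/
theorem prefers_lowerPrices_of_outsideSurplus_le {b : B} (hb : b ∉ buyersOf v P S) {j : M}
    (h : outsideSurplus v P S b ≤ v b j - lowerPrices v P S j) :
    Prefers v (lowerPrices v P S) b j := by
  obtain ⟨h0, hout⟩ := outsideSurplus_le_iff.1 h
  refine ⟨h0, fun k => ?_⟩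
  by_cases hk : k ∈ S
  · rw [lowerPrices_of_mem hk]
    linarith [add_priceReduction_le hb hk]
  · rw [lowerPrices_of_notMem hk]
    exact hout k hk

theorem Prefers.lowerPrices_of_notMem {b : B} (hb : b ∉ buyersOf v P S) {j : M}
    (h : Prefers v P b j) (hj : j ∉ S) : Prefers v (lowerPrices v P S) b j := by
  apply prefers_lowerPrices_of_outsideSurplus_le hb
  rw [MatchingMarket.lowerPrices_of_notMem hj]
  exact outsideSurplus_le_iff.2 ⟨h.1, fun k _ => h.2 k⟩

theorem exists_new_buyer (hcard : Fintype.card B = Fintype.card M) (hS : IsConstricted v P S) :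
    ∃ b ∉ buyersOf v P S, b ∈ buyersOf v (lowerPrices v P S) S := by
  obtain ⟨b, hb, l, hl, he⟩ := exists_add_priceReduction_eq hcard hS
  refine ⟨b, hb, mem_buyersOf.2 ⟨l, hl, prefers_lowerPrices_of_outsideSurplus_le hb ?_⟩⟩
  rw [lowerPrices_of_mem hl]
  linarith

/-- The new `N(T)` contains the disjoint old sets `N(T ∩ S)` and `N(S ∪ T) \ N(S)`; the latter has
at least `|T \ S|` buyers because `S` has maximal excess. -/
theorem excess_lowerPrices_le (hcard : Fintype.card B = Fintype.card M)
    (hS : IsLeastMaxExcess v P S) (T : Finset M) :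
    excess v (lowerPrices v P S) T ≤ excess v P (T ∩ S) := by
  have hc := (priceReduction_pos hcard hS.isConstricted).le
  have hsub : buyersOf v P (T ∩ S) ∪ (buyersOf v P (S ∪ T) \ buyersOf v P S) ⊆
      buyersOf v (lowerPrices v P S) T := by
    intro b hb
    rcases Finset.mem_union.1 hb with hb | hb
    · obtain ⟨j, hj, h⟩ := mem_buyersOf.1 hb
      rw [Finset.mem_inter] at hj
      exact mem_buyersOf.2 ⟨j, hj.1, h.lowerPrices_of_mem hc hj.2⟩
    · obtain ⟨hb1, hb2⟩ := Finset.mem_sdiff.1 hb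
      obtain ⟨j, hj, h⟩ := mem_buyersOf.1 hb1
      have hjS : j ∉ S := fun hjS => hb2 (mem_buyersOf.2 ⟨j, hjS, h⟩)
      exact mem_buyersOf.2 ⟨j, (Finset.mem_union.1 hj).resolve_left hjS,
        h.lowerPrices_of_notMem hb2 hjS⟩
  have hmono : ∀ {U V : Finset M}, U ⊆ V → buyersOf v P U ⊆ buyersOf v P V := by
    intro U V hUV b hb
    obtain ⟨j, hj, h⟩ := mem_buyersOf.1 hb
    exact mem_buyersOf.2 ⟨j, hUV hj, h⟩
  have hdisj : Disjoint (buyersOf v P (T ∩ S)) (buyersOf v P (S ∪ T) \ buyersOf v P S) :=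
    Finset.disjoint_sdiff.mono_left (hmono Finset.inter_subset_right)
  have h1 := Finset.card_le_card hsub
  rw [Finset.card_union_of_disjoint hdisj] at h1
  have h2 := Finset.card_sdiff_add_card_eq_card (hmono (Finset.subset_union_left : S ⊆ S ∪ T))
  have h3 := Finset.card_union_add_card_inter S T
  rw [Finset.inter_comm S T] at h3
  have h4 := (hS.2 (S ∪ T)).1
  unfold excess at h4 ⊢
  omega

/-- Either the excess drops by at least one, or `S ⊆ T`. In the second case `T = S` is excluded by
the new neighbour of `S`, so `1 / |T|` is smaller. -/
theorem skewness_lowerPrices_lt (hcard : Fintype.card B = Fintype.card M)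
    (hS : IsLeastMaxExcess v P S) {T : Finset M} (hT : T.Nonempty) :
    skewness v (lowerPrices v P S) T < skewness v P S := by
  have hS0 : (0 : ℝ) < S.card := by exact_mod_cast hS.nonempty.card_pos
  have hT0 : (0 : ℝ) < T.card := by exact_mod_cast hT.card_pos
  have hle := excess_lowerPrices_le hcard hS T
  have hle' := (hS.2 (T ∩ S)).1
  rw [skewness_eq_excess_add, skewness_eq_excess_add]
  rcases (hle.trans hle').lt_or_eq with hlt | heq
  · have h1 : (excess v (lowerPrices v P S) T : ℝ) + 1 ≤ excess v P S := by exact_mod_cast hlt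
    have h2 : 1 / (T.card : ℝ) ≤ 1 := by
      rw [div_le_one hT0]
      exact_mod_cast hT.card_pos
    have h3 : 0 < 1 / (S.card : ℝ) := by positivity
    linarith
  · have hsub : S ⊆ T := ((hS.2 (T ∩ S)).2 (by omega)).trans Finset.inter_subset_left
    have hne : S ≠ T := by
      rintro rfl
      obtain ⟨b, hb, hb'⟩ := exists_new_buyer hcard hS.isConstricted
      have hss : buyersOf v P S ⊂ buyersOf v (lowerPrices v P S) S := by
        refine ⟨fun a ha => ?_, fun h => hb (h hb')⟩
        obtain ⟨j, hj, h⟩ := mem_buyersOf.1 ha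
        exact mem_buyersOf.2 ⟨j, hj,
          h.lowerPrices_of_mem (priceReduction_pos hcard hS.isConstricted).le hj⟩
      have := Finset.card_lt_card hss
      unfold excess at heq
      omega
    have hlt : (S.card : ℝ) < T.card := by
      exact_mod_cast Finset.card_lt_card (hsub.ssubset_of_ne hne)
    rw [heq]
    have := one_div_lt_one_div_of_lt hS0 hlt
    linarith

/-- Lowering the prices of the least set of maximal excess keeps them above every
market-clearing price vector. -/
theorem IsMarketClearing.le_lowerPrices (hS : IsLeastMaxExcess v P S) {Q : M → ℝ}
    (hQ : IsMarketClearing v Q) (hQP : Q ≤ P) :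
    Q ≤ lowerPrices v P S := by
  obtain ⟨σ, hσ⟩ := hQ
  set T := S.filter fun j => P j - priceReduction v P S < Q j with hTdef
  by_contra hnot
  have hTne : T.Nonempty := by
    simp only [Pi.le_def, not_forall, not_le] at hnot
    obtain ⟨j, hj⟩ := hnot
    by_cases hjS : j ∈ S
    · rw [lowerPrices_of_mem hjS] at hj
      exact ⟨j, Finset.mem_filter.2 ⟨hjS, hj⟩⟩
    · rw [lowerPrices_of_notMem hjS] at hj
      exact absurd (hQP j) (not_le.2 hj)
  have hTS : T ⊆ S := Finset.filter_subset _ _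
  have hlt := hS.excess_lt_of_ssubset (Finset.sdiff_ssubset hTS hTne)
  -- The buyers matched to `T` at `Q` lie in `N(S)` but not in `N(S \ T)`. Counting them gives `S \
  -- T` at least the excess of `S`, against leastness.
  have hsub : T.map σ.symm.toEmbedding ⊆ buyersOf v P S \ buyersOf v P (S \ T) := by
    intro b hb
    obtain ⟨j, hj, rfl⟩ := Finset.mem_map.1 hb
    obtain ⟨hjS, hjQ⟩ := Finset.mem_filter.1 hj
    change σ.symm j ∈ _
    have hpref : Prefers v Q (σ.symm j) j := by simpa using hσ (σ.symm j)
    generalize σ.symm j = b at hpref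
    rw [Finset.mem_sdiff]
    constructor
    · by_contra hb
      have h1 := add_priceReduction_le hb hjS
      have h2 : outsideSurplus v P S b ≤ v b j - Q j :=
        outsideSurplus_le_iff.2 ⟨hpref.1, fun k _ => by linarith [hpref.2 k, hQP k]⟩
      linarith
    -- From `P` to `Q`, the price of `l` falls by at least the reduction and that of `j` by less, so
    -- at `Q` the buyer would favour `l` over `j`.
    · intro hb
      obtain ⟨l, hl, h⟩ := mem_buyersOf.1 hb
      obtain ⟨hlS, hlT⟩ := Finset.mem_sdiff.1 hl
      have hlQ : Q l ≤ P l - priceReduction v P S := by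
        by_contra! hh
        exact hlT (Finset.mem_filter.2 ⟨hlS, hh⟩)
      linarith [h.2 j, hpref.2 l]
  have hcle := Finset.card_le_card hsub
  rw [Finset.card_map] at hcle
  have hN : buyersOf v P (S \ T) ⊆ buyersOf v P S := by
    intro b hb
    obtain ⟨j, hj, h⟩ := mem_buyersOf.1 hb
    exact mem_buyersOf.2 ⟨j, (Finset.mem_sdiff.1 hj).1, h⟩
  have h1 := Finset.card_sdiff_add_card_eq_card hN
  have h2 := Finset.card_sdiff_add_card_eq_card hTS
  unfold excess at hlt
  omega

/-- Every non-empty set of buyers with positive surplus has more neighbours than members. -/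
def StrictHall (v : B → M → ℝ) (P : M → ℝ) : Prop :=
  ∀ A : Finset B, A.Nonempty → (∀ b ∈ A, ∃ k, 0 < v b k - P k) → A.card < (goodsOf v P A).card

/-- Deleting the neighbours of `A` from `S` removes all of `A` from `N(S)`, yet must lower the
excess. -/
theorem IsLeastMaxExcess.card_lt_card_goodsOf_inter (hS : IsLeastMaxExcess v P S)
    {A : Finset B} (hA : A.Nonempty) (hAS : A ⊆ buyersOf v P S) :
    A.card < (goodsOf v P A ∩ S).card := by
  obtain ⟨b, hb⟩ := hA
  obtain ⟨j, hj, hbj⟩ := mem_buyersOf.1 (hAS hb)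
  have hss : S \ (goodsOf v P A ∩ S) ⊂ S :=
    Finset.sdiff_ssubset Finset.inter_subset_right
      ⟨j, Finset.mem_inter.2 ⟨mem_goodsOf.2 ⟨b, hb, hbj⟩, hj⟩⟩
  have hlt := hS.excess_lt_of_ssubset hss
  have hsub : buyersOf v P (S \ (goodsOf v P A ∩ S)) ⊆ buyersOf v P S \ A := by
    intro a ha
    obtain ⟨k, hk, hak⟩ := mem_buyersOf.1 ha
    obtain ⟨hkS, hkA⟩ := Finset.mem_sdiff.1 hk
    refine Finset.mem_sdiff.2 ⟨mem_buyersOf.2 ⟨k, hkS, hak⟩, fun haA => hkA ?_⟩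
    exact Finset.mem_inter.2 ⟨mem_goodsOf.2 ⟨a, haA, hak⟩, hkS⟩
  have h1 := Finset.card_le_card hsub
  have h2 := Finset.card_sdiff_add_card_eq_card hAS
  have h3 := Finset.card_sdiff_add_card_eq_card
    (Finset.inter_subset_right : goodsOf v P A ∩ S ⊆ S)
  unfold excess at hlt
  omega

/-- Buyers of `A` in `N(S)` keep their edges into `S`, the others keep theirs outside `S`, so the
two strict inequalities add up. -/
theorem StrictHall.lowerPrices (hcard : Fintype.card B = Fintype.card M)
    (hS : IsLeastMaxExcess v P S) (hP : StrictHall v P) :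
    StrictHall v (lowerPrices v P S) := by
  intro A hA hpos
  have hc := (priceReduction_pos hcard hS.isConstricted).le
  set A₁ := A ∩ buyersOf v P S with hA₁
  set A₂ := A \ buyersOf v P S with hA₂
  have hmem₂ : ∀ {b}, b ∈ A₂ → b ∈ A ∧ b ∉ buyersOf v P S := fun h => Finset.mem_sdiff.1 h
  have hnot : ∀ {j}, j ∈ goodsOf v P A₂ → j ∉ S := by
    intro j hj hjS
    obtain ⟨b, hb, h⟩ := mem_goodsOf.1 hj
    exact (hmem₂ hb).2 (mem_buyersOf.2 ⟨j, hjS, h⟩)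
  have hsub : (goodsOf v P A₁ ∩ S) ∪ goodsOf v P A₂ ⊆
      goodsOf v (MatchingMarket.lowerPrices v P S) A := by
    intro j hj
    rcases Finset.mem_union.1 hj with hj | hj
    · obtain ⟨hj, hjS⟩ := Finset.mem_inter.1 hj
      obtain ⟨b, hb, h⟩ := mem_goodsOf.1 hj
      exact mem_goodsOf.2 ⟨b, (Finset.mem_inter.1 hb).1, h.lowerPrices_of_mem hc hjS⟩
    · obtain ⟨b, hb, h⟩ := mem_goodsOf.1 hj
      exact mem_goodsOf.2 ⟨b, (hmem₂ hb).1, h.lowerPrices_of_notMem (hmem₂ hb).2 (hnot hj)⟩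
  have hdisj : Disjoint (goodsOf v P A₁ ∩ S) (goodsOf v P A₂) :=
    Finset.disjoint_left.2 fun j h h' => hnot h' (Finset.mem_inter.1 h).2
  have hle := Finset.card_le_card hsub
  rw [Finset.card_union_of_disjoint hdisj] at hle
  have hsum : A₂.card + A₁.card = A.card := by
    rw [hA₁, hA₂, Finset.card_sdiff_add_card_inter]
  have h₁ : A₁.Nonempty → A₁.card < (goodsOf v P A₁ ∩ S).card := fun h =>
    hS.card_lt_card_goodsOf_inter h Finset.inter_subset_right
  have h₂ : A₂.Nonempty → A₂.card < (goodsOf v P A₂).card := by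
    intro h
    refine hP A₂ h fun b hb => ?_
    obtain ⟨hbA, hbS⟩ := hmem₂ hb
    obtain ⟨k, hk⟩ := hpos b hbA
    by_cases hkS : k ∈ S
    · rw [lowerPrices_of_mem hkS] at hk
      -- The outside option at the old prices is at least the new surplus at `k`, hence positive.
      apply exists_pos_of_outsideSurplus_pos (S := S)
      linarith [add_priceReduction_le hbS hkS]
    · rw [lowerPrices_of_notMem hkS] at hk
      exact ⟨k, hk⟩
  have hApos := hA.card_pos
  rw [← Finset.card_pos] at h₁ h₂
  omega

/-- A negative new price would give every buyer outside `N(S)` a positive surplus at the old prices.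
`StrictHall` then gives `|N(S)ᶜ| < |Sᶜ|`, but `S` is constricted. -/
theorem lowerPrices_nonneg (hcard : Fintype.card B = Fintype.card M) (hv : ∀ b j, 0 ≤ v b j)
    (hS : IsLeastMaxExcess v P S) (hH : StrictHall v P) (hP : ∀ j, 0 ≤ P j) (j : M) :
    0 ≤ lowerPrices v P S j := by
  by_cases hj : j ∈ S
  swap
  · rw [lowerPrices_of_notMem hj]
    exact hP j
  rw [lowerPrices_of_mem hj]
  by_contra! hneg
  have hcon := hS.isConstricted
  unfold IsConstricted at hcon
  have h1 := Finset.card_compl_add_card (buyersOf v P S)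
  have h2 := Finset.card_compl_add_card S
  have hne : ((buyersOf v P S)ᶜ).Nonempty := by
    rw [← Finset.card_pos]
    omega
  have hlt := hH _ hne fun b hb => by
    have hb' := Finset.mem_compl.1 hb
    apply exists_pos_of_outsideSurplus_pos (S := S)
    linarith [add_priceReduction_le hb' hj, hv b j]
  have hsub : goodsOf v P (buyersOf v P S)ᶜ ⊆ Sᶜ := by
    intro k hk
    obtain ⟨b, hb, h⟩ := mem_goodsOf.1 hk
    exact Finset.mem_compl.2 fun hkS => Finset.mem_compl.1 hb (mem_buyersOf.2 ⟨k, hkS, h⟩)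
  have := Finset.card_le_card hsub
  omega

end Round

/-! ### Initial prices, the dummy good and termination -/

theorem le_initialPrices [Fintype B] (v : B → M → ℝ) (b : B) (j : M) : v b j ≤ initialPrices v j :=
  le_ciSup (f := fun b => v b j) (Set.finite_range _).bddAbove b

theorem some_mem_goodsOfWithDummy [Fintype M] {v : B → M → ℝ} {P : M → ℝ} {A : Finset B}
    {j : M} (hj : j ∈ goodsOf v P A) :
    some j ∈ goodsOfWithDummy v P A := by
  obtain ⟨b, hb, h⟩ := mem_goodsOf.1 hj
  refine mem_goodsOf.2 ⟨b, hb, h.1, fun k => ?_⟩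
  cases k with
  | none => simpa using h.1
  | some k => exact h.2 k

theorem none_mem_goodsOfWithDummy [Fintype M] {v : B → M → ℝ} {P : M → ℝ} {A : Finset B}
    {b : B} (hb : b ∈ A)
    (h : ∀ k, v b k - P k ≤ 0) : none ∈ goodsOfWithDummy v P A := by
  refine mem_goodsOf.2 ⟨b, hb, by simp, fun k => ?_⟩
  cases k with
  | none => exact le_rfl
  | some k => simpa using h k

section Termination

variable [Fintype B] [Fintype M] {v : B → M → ℝ}

theorem Stops.isMarketClearing (hcard : Fintype.card B = Fintype.card M) {P : M → ℝ}
    (hP : Stops v P) : IsMarketClearing v P := by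
  have hHall := (Finset.all_card_le_biUnion_card_iff_exists_injective
    fun j : M => buyersOf v P {j}).1 fun S => by
      have hS : (buyersOf v P S) = S.biUnion fun j => buyersOf v P {j} := by
        ext b
        simp [mem_buyersOf]
      rw [← hS]
      by_contra! h
      exact hP ⟨S, h⟩
  obtain ⟨f, hinj, hf⟩ := hHall
  have hbij : Function.Bijective f :=
    (Fintype.bijective_iff_injective_and_card f).2 ⟨hinj, hcard.symm⟩
  refine ⟨(Equiv.ofBijective f hbij).symm, fun b => ?_⟩
  obtain ⟨j, rfl⟩ := hbij.2 b
  rw [Equiv.ofBijective_symm_apply_apply]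
  simpa [mem_buyersOf] using hf j

theorem round_eq_lowerPrices {P : M → ℝ} (hP : ¬ Stops v P) :
    round v P = lowerPrices v P (maximallySkewedSet v P) := if_neg hP

theorem isLeastMaxExcess_maximallySkewedSet {P : M → ℝ} (hP : ¬ Stops v P) :
    IsLeastMaxExcess v P (maximallySkewedSet v P) :=
  (isMaximallySkewed_maximallySkewedSet hP).isLeastMaxExcess hP

theorem finite_range_skewness :
    (Set.range fun p : (M → ℝ) × Finset M => skewness v p.1 p.2).Finite := by
  refine (Set.finite_range fun q : Finset M × Finset B =>
    (q.1.card : ℝ) - (q.2.card : ℝ) + 1 / (q.1.card : ℝ)).subset ?_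
  rintro _ ⟨p, rfl⟩
  exact ⟨(p.2, buyersOf v p.1 p.2), rfl⟩

theorem exists_stops (hcard : Fintype.card B = Fintype.card M) :
    ∃ t, Stops v (prices v t) := by
  by_contra! h
  let w : ℕ → ℝ := fun t => skewness v (prices v t) (maximallySkewedSet v (prices v t))
  have hanti : StrictAnti w := strictAnti_nat_of_succ_lt fun t => by
    have hne := (isLeastMaxExcess_maximallySkewedSet (h (t + 1))).nonempty
    have hlt := skewness_lowerPrices_lt hcard (isLeastMaxExcess_maximallySkewedSet (h t)) hne
    rw [← round_eq_lowerPrices (h t)] at hlt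
    exact hlt
  refine Set.infinite_range_of_injective hanti.injective (finite_range_skewness (v := v) |>.subset ?_)
  rintro _ ⟨t, rfl⟩
  exact ⟨(_, _), rfl⟩

theorem prices_invariant (hcard : Fintype.card B = Fintype.card M) (hv : ∀ b j, 0 ≤ v b j)
    (t : ℕ) : StrictHall v (prices v t) ∧ (∀ j, 0 ≤ prices v t j) ∧
      ∀ Q, IsMarketClearing v Q → Q ≤ prices v t := by
  induction t with
  | zero =>
    -- No surplus is positive at the initial prices, so `StrictHall` holds vacuously.
    refine ⟨fun A ⟨b, hb⟩ hpos => ?_, fun j => Real.iSup_nonneg fun b => hv b j,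
      fun Q ⟨σ, hσ⟩ j => ?_⟩
    · obtain ⟨k, hk⟩ := hpos b hb
      have := le_initialPrices v b k
      change 0 < v b k - initialPrices v k at hk
      linarith
    · have h := (hσ (σ.symm j)).1
      rw [Equiv.apply_symm_apply] at h
      have := le_initialPrices v (σ.symm j) j
      change Q j ≤ initialPrices v j
      linarith
  | succ t ih =>
    obtain ⟨hH, h0, hQ⟩ := ih
    change StrictHall v (round v (prices v t)) ∧ (∀ j, 0 ≤ round v (prices v t) j) ∧
      ∀ Q, IsMarketClearing v Q → Q ≤ round v (prices v t)
    by_cases hs : Stops v (prices v t)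
    · rw [round, if_pos hs]
      exact ⟨hH, h0, hQ⟩
    · have hS := isLeastMaxExcess_maximallySkewedSet hs
      rw [round_eq_lowerPrices hs]
      exact ⟨hH.lowerPrices hcard hS, lowerPrices_nonneg hcard hv hS hH h0,
        fun Q h => h.le_lowerPrices hS (hQ Q h)⟩

/-- If some buyer of `A` has no positive surplus, the dummy good joins the `|A|` matched goods;
otherwise `StrictHall` applies. -/
theorem StrictHall.card_lt_card_goodsOfWithDummy {P : M → ℝ} (hH : StrictHall v P)
    (hP : IsMarketClearing v P) {A : Finset B} (hA : A.Nonempty) :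
    A.card < (goodsOfWithDummy v P A).card := by
  by_cases hpos : ∀ b ∈ A, ∃ k, 0 < v b k - P k
  · refine (hH A hA hpos).trans_le ?_
    rw [← Finset.card_map Function.Embedding.some]
    refine Finset.card_le_card fun x hx => ?_
    obtain ⟨j, hj, rfl⟩ := Finset.mem_map.1 hx
    exact some_mem_goodsOfWithDummy hj
  · push Not at hpos
    obtain ⟨b, hb, hle⟩ := hpos
    obtain ⟨σ, hσ⟩ := hP
    have h1 : (A.map σ.toEmbedding).card ≤ (goodsOf v P A).card := by
      refine Finset.card_le_card fun j hj => ?_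
      obtain ⟨a, ha, rfl⟩ := Finset.mem_map.1 hj
      exact mem_goodsOf.2 ⟨a, ha, hσ a⟩
    rw [Finset.card_map] at h1
    have h2 : (Finset.insertNone (goodsOf v P A)).card ≤ (goodsOfWithDummy v P A).card := by
      refine Finset.card_le_card fun x hx => ?_
      cases x with
      | none => exact none_mem_goodsOfWithDummy hb hle
      | some j => exact some_mem_goodsOfWithDummy (Finset.some_mem_insertNone.1 hx)
    rw [Finset.card_insertNone] at h2
    omega

end Termination

end

end MatchingMarket

theorem mainTheorem1 {B M : Type*} [Fintype B] [Fintype M]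
    (hcard : Fintype.card B = Fintype.card M)
    (v : B → M → ℝ) (hv : ∀ b j, 0 ≤ v b j) :
    ∃ T : ℕ,
      -- before time `T` the algorithm runs, and the set that it uses is well defined
      (∀ t < T, ¬ MatchingMarket.Stops v (MatchingMarket.prices v t) ∧
        (∃! S, MatchingMarket.IsMaximallySkewed v (MatchingMarket.prices v t) S) ∧
        MatchingMarket.IsConstricted v (MatchingMarket.prices v t)
          (MatchingMarket.maximallySkewedSet v (MatchingMarket.prices v t)) ∧
        0 < MatchingMarket.priceReduction v (MatchingMarket.prices v t)
          (MatchingMarket.maximallySkewedSet v (MatchingMarket.prices v t))) ∧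
      -- at time `T` it stops, at the maximum market-clearing price vector
      MatchingMarket.Stops v (MatchingMarket.prices v T) ∧
      IsGreatest {P : M → ℝ | MatchingMarket.IsMarketClearing v P} (MatchingMarket.prices v T) ∧
      (∀ j, 0 ≤ MatchingMarket.prices v T j) ∧
      -- the neighbourhood inequality at termination
      ∀ A : Finset B, A.Nonempty →
        A.card < (MatchingMarket.goodsOfWithDummy v (MatchingMarket.prices v T) A).card := by
  classical
  have hex := MatchingMarket.exists_stops (v := v) hcard
  obtain ⟨hH, h0, hQ⟩ := MatchingMarket.prices_invariant hcard hv (Nat.find hex)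
  have hclear := (Nat.find_spec hex).isMarketClearing hcard
  refine ⟨Nat.find hex, fun t ht => ?_, Nat.find_spec hex, ⟨hclear, hQ⟩, h0,
    fun A hA => hH.card_lt_card_goodsOfWithDummy hclear hA⟩
  have hs := Nat.find_min hex ht
  have hcon := (MatchingMarket.isLeastMaxExcess_maximallySkewedSet hs).isConstricted
  exact ⟨hs, MatchingMarket.existsUnique_isMaximallySkewed hs, hcon,
    MatchingMarket.priceReduction_pos hcard hcon⟩
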